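/- Consider an auction of $m$ identical units among $n$ agents with unit demand, where $1\le m<n$. The type $\theta_i$ of agent $i$ (the valuation for one unit) lies in $[L,U]$, $0\le L\le U$; a decision $d$ is a set of at most $m$ winners, and $v_i(d,\theta_i)=\theta_i$ if $i$ wins and $0$ otherwise. A mechanism $(f,t)$ consists of a decision function $f$ and payments $t_i(\theta)$, with utilities $u_i(\theta)=v_i(f(\theta),\theta_i)-t_i(\theta)$. It is a Groves mechanism if $f(\theta)$ maximizes $\sum_i v_i(d,\theta_i)$ over $d$ for every $\theta$ and $t_i(\theta)=h_i(\theta_{-i})-\sum_{j\ne i}v_j(f(\theta),\theta_j)$ for some functions $h_i$, where $\theta_{-i}$ is the vector of types of the other agents; equivalently, $t_i(\theta)=VCG_i(\theta)-r_i(\theta_{-i})$ for some functions $r_i$, where $VCG_i(\theta)=\max_d\sum_{j\ne i}v_j(d,\theta_j)-\sum_{j\ne i}v_j(f(\theta),\theta_j)$. It is non-deficit if $\sum_i t_i(\theta)\ge 0$ for all $\theta$. It is anonymous and linear if there are constants $c_0,\dots,c_{n-1}$ such that $r_i(\theta_{-i})=c_0+\sum_{j=1}^{n-1}c_j[\theta_{-i}]_j$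 for all $i$ and $\theta$, where $[\theta_{-i}]_j$ is the $j$th highest entry of $\theta_{-i}$. A non-deficit Groves mechanism is individually undominated if there is no non-deficit Groves mechanism with utilities $u'_i$ such that $u'_i(\theta)\ge u_i(\theta)$ for all $i$ and $\theta$, with strict inequality for some $i$ and $\theta$. Put $a_i=(-1)^{m-i}\binom{n-i-1}{n-m-1}/\binom{m-1}{i-1}$ for $1\le i\le m$ and $b_i=(-1)^{m-i-1}\binom{i-1}{m-1}/\binom{n-m-1}{n-i-1}$ for $m+1\le i\le n-1$. An OEL mechanism is a Groves mechanism that is anonymous and linear with the following coefficients for some integer index $k$ with $0\le k\le n$ and $k-m$ odd (coefficients that are not listed are $0$): - $k=0$: $c_i=a_i$ for $1\le i\le m$, and $c_0=\frac{Um}{n}-U\sum_{i=1}^m a_i$; - $1\le k\le m$: $c_i=a_i$ for $k+1\le i\le m$, and $c_k=\frac mn-\sum_{i=k+1}^m a_i$; - $m+1\le k\le n-1$: $c_i=b_i$ for $m+1\le i\le k-1$, and $c_k=\frac mn-\sum_{i=m+1}^{k-1}b_i$; - $k=n$: $c_i=b_i$ for $m+1\le i\le n-1$, and $c_0=\frac{Lm}{n}-L\sum_{i=m+1}^{n-1}b_i$.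 Theorem. Every anonymous linear non-deficit Groves mechanism that is individually undominated is an OEL mechanism. -/

import Mathlib

/-- A decision problem for `n` agents: a set of decisions, a set of types for every agent and an
initial utility function for every agent. -/
structure DecisionProblem (n : ℕ) where
  /-- the possible decisions -/
  Decision : Type
  /-- the possible types of each agent -/
  Ty : Fin n → Type
  /-- the initial utility (valuation) of each agent -/
  val : (i : Fin n) → Decision → Ty i → ℝ

namespace DecisionProblem

variable {n : ℕ} (P : DecisionProblem n)

/-- A type profile: one type for every agent. -/
abbrev Profile : Type := (i : Fin n) → P.Ty i

/-- The possible type vectors of the agents other than `i`. -/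
abbrev OthersProfile (i : Fin n) : Type := (j : {j : Fin n // j ≠ i}) → P.Ty j

variable {P}

/-- The vector of the types of the agents other than `i` in the profile `θ`. -/
def others (i : Fin n) (θ : P.Profile) : P.OthersProfile i := fun j => θ j

/-- The total valuation of the agents other than `i` under the decision `d`. -/
noncomputable def othersWelfare (i : Fin n) (d : P.Decision) (θ : P.Profile) : ℝ :=
  ∑ j ∈ Finset.univ.erase i, P.val j d (θ j)

end DecisionProblem

/-- A payment-based mechanism: a decision function `f` and a payment function `t`, where
`t θ i` is what agent `i` pays (if it is negative, the agent receives money). -/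
structure Mechanism {n : ℕ} (P : DecisionProblem n) where
  /-- the decision function -/
  f : P.Profile → P.Decision
  /-- the payment function -/
  t : P.Profile → Fin n → ℝ

namespace Mechanism

variable {n : ℕ} {P : DecisionProblem n}

/-- The final utility of agent `i` when all agents report their true types `θ`. -/
def utility (M : Mechanism P) (θ : P.Profile) (i : Fin n) : ℝ :=
  P.val i (M.f θ) (θ i) - M.t θ i

/-- The decision taken always maximizes the total valuation of the agents. -/
def Efficient (M : Mechanism P) : Prop :=
  ∀ (θ : P.Profile) (d : P.Decision), ∑ i, P.val i d (θ i) ≤ ∑ i, P.val i (M.f θ) (θ i)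

/-- The total payment of the agents is never negative. -/
def NonDeficit (M : Mechanism P) : Prop := ∀ θ : P.Profile, 0 ≤ ∑ i, M.t θ i

/-- Groves mechanisms: the decision function is efficient, and
`t_i(θ) = h_i(θ_{-i}) - ∑_{j ≠ i} v_j(f(θ), θ_j)` for some functions `h_i`. -/
def IsGroves (M : Mechanism P) : Prop :=
  M.Efficient ∧ ∃ h : (i : Fin n) → P.OthersProfile i → ℝ, ∀ (θ : P.Profile) (i : Fin n),
    M.t θ i = h i (P.others i θ) - P.othersWelfare i (M.f θ) θ

/-- `M'` individually dominates `M`: every agent is always at least as well off under `M'`, and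
some agent is sometimes strictly better off. -/
def IndividuallyDominates (M' M : Mechanism P) : Prop :=
  (∀ (θ : P.Profile) (i : Fin n), M.utility θ i ≤ M'.utility θ i) ∧
    ∃ (θ : P.Profile) (i : Fin n), M.utility θ i < M'.utility θ i

/-- `M` is not individually dominated by any non-deficit Groves mechanism. -/
def IndividuallyUndominated (M : Mechanism P) : Prop :=
  ∀ M' : Mechanism P, M'.IsGroves → M'.NonDeficit → ¬ M'.IndividuallyDominates M

/-- The VCG (Clarke) payment of agent `i` under the decision function of `M`. (The supremum is a
maximum, since the set of decisions is finite wherever this is used.) -/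
noncomputable def vcgPayment (M : Mechanism P) (θ : P.Profile) (i : Fin n) : ℝ :=
  (⨆ d : P.Decision, P.othersWelfare i d θ) - P.othersWelfare i (M.f θ) θ

/-- `r` is the redistribution function of `M`: agent `i` makes the VCG payment and receives
`r_i(θ_{-i})`. -/
def HasRedistribution (M : Mechanism P) (r : (i : Fin n) → P.OthersProfile i → ℝ) : Prop :=
  ∀ (θ : P.Profile) (i : Fin n), M.t θ i = M.vcgPayment θ i - r i (P.others i θ)

end Mechanism

namespace UnitDemand

/-- Auction of `m` identical units among `n` agents with unit demand. A decision is the set of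
the (at most `m`) winners; the type of an agent is the valuation in `[L, U]` for one unit. -/
noncomputable def auction (n m : ℕ) (L U : ℝ) : DecisionProblem n where
  Decision := {W : Finset (Fin n) // W.card ≤ m}
  Ty := fun _ => Set.Icc L U
  val := fun i W x => if i ∈ W.1 then (x : ℝ) else 0

/-- `nthHighest x j` is the `j`-th highest entry of the family `x` (`j = 1` is the maximum), for
`1 ≤ j ≤` the number of entries. -/
noncomputable def nthHighest {ι : Type} [Fintype ι] (x : ι → ℝ) (j : ℕ) : ℝ :=
  ((Finset.univ.val.map x).sort (· ≥ ·)).getD (j - 1) 0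

variable {n m : ℕ} {L U : ℝ}

/-- The type of an agent, as a real number. -/
def bid {i : Fin n} (x : (auction n m L U).Ty i) : ℝ :=
  Subtype.val (p := fun y : ℝ => y ∈ Set.Icc L U) x

/-- The anonymous linear redistribution function with coefficients `c`:
`r(θ_{-i}) = c_0 + ∑_{j=1}^{n-1} c_j [θ_{-i}]_j`, the same for all agents. -/
noncomputable def linearRedistribution (c : ℕ → ℝ) (i : Fin n)
    (x : (auction n m L U).OthersProfile i) : ℝ :=
  c 0 + ∑ j ∈ Finset.Icc 1 (n - 1), c j * nthHighest (fun a => bid (x a)) j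

/-- The redistribution function of `M` is anonymous and linear. -/
def IsAnonymousLinear (M : Mechanism (auction n m L U)) : Prop :=
  ∃ c : ℕ → ℝ, M.HasRedistribution (linearRedistribution c)

/-- `(-1)^(m-i) * C(n-i-1, n-m-1) / C(m-1, i-1)`, used for `1 ≤ i ≤ m`. -/
noncomputable def lowCoeff (n m i : ℕ) : ℝ :=
  (-1 : ℝ) ^ ((m : ℤ) - (i : ℤ)) * ((n - i - 1).choose (n - m - 1) : ℝ)
    / ((m - 1).choose (i - 1) : ℝ)

/-- `(-1)^(m-i-1) * C(i-1, m-1) / C(n-m-1, n-i-1)`, used for `m + 1 ≤ i ≤ n - 1`. -/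
noncomputable def highCoeff (n m i : ℕ) : ℝ :=
  (-1 : ℝ) ^ ((m : ℤ) - (i : ℤ) - 1) * ((i - 1).choose (m - 1) : ℝ)
    / ((n - m - 1).choose (n - i - 1) : ℝ)

/-- The coefficient `c_j` of the OEL mechanism with index `k`, for `0 ≤ k ≤ n`. -/
noncomputable def oelCoeff (n m : ℕ) (L U : ℝ) (k j : ℕ) : ℝ :=
  if k = 0 then
    if j = 0 then U * m / n - U * ∑ i ∈ Finset.Icc 1 m, lowCoeff n m i
    else if j ≤ m then lowCoeff n m j
    else 0
  else if k ≤ m then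
    if j = k then (m : ℝ) / n - ∑ i ∈ Finset.Icc (k + 1) m, lowCoeff n m i
    else if k + 1 ≤ j ∧ j ≤ m then lowCoeff n m j
    else 0
  else if k ≤ n - 1 then
    if j = k then (m : ℝ) / n - ∑ i ∈ Finset.Icc (m + 1) (k - 1), highCoeff n m i
    else if m + 1 ≤ j ∧ j ≤ k - 1 then highCoeff n m j
    else 0
  else
    if j = 0 then L * m / n - L * ∑ i ∈ Finset.Icc (m + 1) (n - 1), highCoeff n m i
    else if m + 1 ≤ j ∧ j ≤ n - 1 then highCoeff n m j
    else 0

/-- `M` is an OEL mechanism: a Groves mechanism whose redistribution function is the linear one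
with the OEL coefficients of some index `0 ≤ k ≤ n` with `k - m` odd. -/
def IsOEL (M : Mechanism (auction n m L U)) : Prop :=
  M.IsGroves ∧ ∃ k : ℕ, k ≤ n ∧ Odd ((k : ℤ) - (m : ℤ)) ∧
    M.HasRedistribution (linearRedistribution (oelCoeff n m L U k))

end UnitDemand

/-!
Write `S 1 ≥ … ≥ S n` for the sorted types. The VCG payments add up to `m * S (m + 1)`
(`sum_vcgPayment`): with `τ = S (m + 1)`, linear programming duality gives the welfare
`∑_j (θ_j - τ)⁺ + m τ` of all agents, and the same expression without the summand `j = i` for the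
best welfare of the agents other than `i`. Hence under a linear redistribution the total payment
is an affine function `surplus` of the sorted types (`sum_payment`). Such a function is determined
by its values `V k` at the step profiles with `k` types `U` and `n - k` types `L`, and `(U - L)`
times its value at `S` is `∑_k (S k - S (k + 1)) V k`, where `S 0 = U` and `S (n + 1) = L`
(`surplus_eq_sum_gap`). Non-deficit makes all `V k` nonnegative.

If the total payment stayed above some `ε > 0` for all types of one agent, against fixed types of
the others, then that agent could be paid `ε` more against these types
(`Mechanism.IndividuallyUndominated.exists_sum_lt`). So in an undominated mechanism one type can
always be chosen to make the total payment arbitrarily small. Against equally spaced types of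
the others, however, a single type closes at most one of the gaps `S k - S (k + 1)`
(`le_gap_add_gap`), so that at most one `V k` is positive (`surplus_step_eq_zero`).

If `V k` is the only nonzero value, then the coefficients of `S j` in `surplus` vanish for all `j`
except `k` and `k + 1`. Read as recurrences for the redistribution coefficients, these equations
yield the OEL coefficients of index `k`; the signs of the two remaining ones, forced by `V k > 0`,
give the parity of `k - m` (`eq_oelCoeff_of_surplus_step`). Some `V k` is positive, since the
total payment cannot vanish at all step profiles except the `m`-th without being negative there
(`surplus_step_neg`). When `L = U` there is a single profile and the index `m + 1` works.
-/

namespace UnitDemand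

/-! ### Order statistics of a vector with one entry deleted -/

/-- If `σ` sorts `θ` decreasingly, then the sorted list of `θ` without its entry at `σ k` is the
sorted list of `θ` with position `k` (counted from `0`) erased. -/
lemma nthHighest_ne {n : ℕ} (θ : Fin n → ℝ) (σ : Equiv.Perm (Fin n)) (hσ : Antitone (θ ∘ σ))
    (k : Fin n) (j : ℕ) (hj : 1 ≤ j) (hjn : j < n) :
    nthHighest (fun a : {a // a ≠ σ k} => θ a) j =
      if j ≤ k then θ (σ ⟨j - 1, by omega⟩) else θ (σ ⟨j, hjn⟩) := by
  set l : List ℝ := List.ofFn (θ ∘ σ) with hl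
  have hlen : l.length = n := by simp [hl]
  have hk : (k : ℕ) < l.length := by omega
  have hls : l.Pairwise (· ≥ ·) := by
    rw [hl, List.pairwise_ofFn]
    intro a b hab
    exact hσ hab.le
  have hcoe : Finset.univ.val.map θ = (l : Multiset ℝ) := by
    have : (Finset.univ.val.map σ : Multiset (Fin n)) = Finset.univ.val := by simp
    rw [← this, Multiset.map_map, hl, List.ofFn_eq_map, Fin.univ_val_map]
    rw [List.ofFn_eq_map]
  have hsub : (Finset.univ.val.map (fun a : {a // a ≠ σ k} => θ a)) =
      ((l.eraseIdx k : List ℝ) : Multiset ℝ) := by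
    have h1 : (Finset.univ.val.map (fun a : {a // a ≠ σ k} => θ a)) =
        ((Finset.univ.erase (σ k)).val.map θ) := by
      have h2 : (Finset.univ.map (Function.Embedding.subtype (fun a => a ≠ σ k))) =
          Finset.univ.erase (σ k) := by
        ext a; simp
      rw [← h2, Finset.map_val, Multiset.map_map]
      rfl
    rw [h1, ← Multiset.cons_inj_right (θ (σ k)), ← Multiset.map_cons, Finset.erase_val,
      Multiset.cons_erase (by simp), hcoe, Multiset.cons_coe, Multiset.coe_eq_coe]
    have := List.getElem_cons_eraseIdx_perm hk
    simpa [hl] using this.symm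
  have hsort : (Finset.univ.val.map (fun a : {a // a ≠ σ k} => θ a)).sort (· ≥ ·) =
      l.eraseIdx k := by
    apply List.Perm.eq_of_pairwise' (Multiset.pairwise_sort _ _)
      (hls.sublist (List.eraseIdx_sublist _ _))
    rw [← Multiset.coe_eq_coe, Multiset.sort_eq, hsub]
  have hlt : j - 1 < (l.eraseIdx k).length := by
    rw [List.length_eraseIdx_of_lt hk]; omega
  rw [nthHighest, hsort, List.getD_eq_getElem _ _ hlt, List.getElem_eraseIdx]
  by_cases h : j ≤ k
  · rw [dif_pos (by omega), if_pos h]; simp [hl]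
  · rw [dif_neg (by omega), if_neg h]
    simp only [hl, List.getElem_ofFn, Function.comp]
    congr 3; omega

/-- The decreasing rearrangement `θ (σ 0) ≥ θ (σ 1) ≥ …` with indices shifted by one, so that
`sorted` is indexed by `1, …, n`, and bordered by the bounds `U` (index `0`) and `L` (index
`n + 1` and beyond). -/
noncomputable def sorted {n : ℕ} (L U : ℝ) (θ : Fin n → ℝ) (σ : Equiv.Perm (Fin n)) (k : ℕ) : ℝ :=
  if k = 0 then U else if h : k - 1 < n then θ (σ ⟨k - 1, h⟩) else L

lemma sorted_succ {n : ℕ} (L U : ℝ) (θ : Fin n → ℝ) (σ : Equiv.Perm (Fin n)) (k : ℕ)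
    (hk : k < n) : sorted L U θ σ (k + 1) = θ (σ ⟨k, hk⟩) := by
  simp [sorted, hk]

lemma nthHighest_others {n : ℕ} (L U : ℝ) (θ : Fin n → ℝ) (σ : Equiv.Perm (Fin n))
    (hσ : Antitone (θ ∘ σ)) (k : Fin n) (j : ℕ) (hj : 1 ≤ j) (hjn : j < n) :
    nthHighest (fun a : {a // a ≠ σ k} => θ a) j =
      if j ≤ k then sorted L U θ σ j else sorted L U θ σ (j + 1) := by
  rw [nthHighest_ne θ σ hσ k j hj hjn, sorted_succ _ _ _ _ _ hjn]
  obtain ⟨j, rfl⟩ := Nat.exists_eq_add_of_le' hj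
  rw [sorted_succ _ _ _ _ _ (by omega)]
  rfl

/-- Deleting one entry of the vector leaves the `j`-th highest entry in place for the `n - j`
entries ranked below it, and moves the next one up for the other `j`. -/
lemma sum_nthHighest_others {n : ℕ} (L U : ℝ) (θ : Fin n → ℝ) (σ : Equiv.Perm (Fin n))
    (hσ : Antitone (θ ∘ σ)) (j : ℕ) (hj : 1 ≤ j) (hjn : j < n) :
    ∑ i : Fin n, nthHighest (fun a : {a // a ≠ i} => θ a) j =
      ((n : ℝ) - j) * sorted L U θ σ j + j * sorted L U θ σ (j + 1) := by
  rw [← Equiv.sum_comp σ]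
  simp_rw [nthHighest_others L U θ σ hσ _ j hj hjn]
  rw [Fin.sum_univ_eq_sum_range
    (fun k => if j ≤ k then sorted L U θ σ j else sorted L U θ σ (j + 1)),
    Finset.sum_ite, Finset.sum_const, Finset.sum_const]
  have h1 : (Finset.range n).filter (fun k => j ≤ k) = Finset.Ico j n := by
    ext a; simp; omega
  have h2 : (Finset.range n).filter (fun k => ¬ j ≤ k) = Finset.range j := by
    ext a; simp; omega
  rw [h1, h2, Nat.card_Ico, Finset.card_range, nsmul_eq_mul, nsmul_eq_mul, Nat.cast_sub hjn.le]

/-! ### Sums of the `m` largest values by duality -/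

/-- If `τ` is a price at which at most `m` agents strictly, and at least `m` agents weakly, want a
unit, then the dual value `∑_j (x_j - τ)⁺ + m τ` is attained by a set of `m` winners. -/
lemma exists_sum_eq_of_threshold {ι : Type*} (s : Finset ι) (x : ι → ℝ)
    (τ : ℝ) (m : ℕ) (h1 : (s.filter (fun j => τ < x j)).card ≤ m)
    (h2 : m ≤ (s.filter (fun j => τ ≤ x j)).card) :
    ∃ W ⊆ s, W.card = m ∧ ∑ j ∈ W, x j = ∑ j ∈ s, max (x j - τ) 0 + m * τ := by
  obtain ⟨W, hW1, hW2, hW3⟩ := Finset.exists_subsuperset_card_eq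
    (Finset.monotone_filter_right s (fun j (_ : j ∈ s) (h : τ < x j) => h.le)) h1 h2
  have hWs : W ⊆ s := hW2.trans (Finset.filter_subset _ _)
  refine ⟨W, hWs, hW3, ?_⟩
  have h3 : ∑ j ∈ s, max (x j - τ) 0 = ∑ j ∈ W, (x j - τ) := by
    rw [← Finset.sum_subset hWs (f := fun j => max (x j - τ) 0)]
    · refine Finset.sum_congr rfl fun j hj => max_eq_left ?_
      have := (Finset.mem_filter.1 (hW2 hj)).2
      linarith
    · intro j hj hjW
      refine max_eq_right ?_
      by_contra hc
      exact hjW (hW1 (Finset.mem_filter.2 ⟨hj, by linarith⟩))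
  rw [h3, Finset.sum_sub_distrib, Finset.sum_const, hW3, nsmul_eq_mul]
  ring

/-- Weak duality: for any price `τ ≥ 0`, the dual value bounds the value of `m` winners. -/
lemma sum_le_of_card_le {ι : Type*} [DecidableEq ι] (s W : Finset ι) (x : ι → ℝ)
    (τ : ℝ) (hτ : 0 ≤ τ) (m : ℕ) (hW : W.card ≤ m) :
    ∑ j ∈ s, (if j ∈ W then x j else 0) ≤ ∑ j ∈ s, max (x j - τ) 0 + m * τ := by
  have h1 : ∑ j ∈ s, (if j ∈ W then x j else 0) ≤
      ∑ j ∈ s, (max (x j - τ) 0 + if j ∈ W then τ else 0) := by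
    refine Finset.sum_le_sum fun j _ => ?_
    split_ifs
    · linarith [le_max_left (x j - τ) 0]
    · linarith [le_max_right (x j - τ) 0]
  refine h1.trans ?_
  rw [Finset.sum_add_distrib, ← Finset.sum_filter, Finset.sum_const, nsmul_eq_mul]
  have h2 : ((s.filter (· ∈ W)).card : ℝ) ≤ m := by
    exact_mod_cast (Finset.card_le_card (fun j hj => (Finset.mem_filter.1 hj).2)).trans hW
  gcongr

variable {n m : ℕ} {L U : ℝ}

/-! ### The total VCG payment -/

/-- The types of a profile, as real numbers. -/
noncomputable def bids (θ : (auction n m L U).Profile) (i : Fin n) : ℝ := bid (θ i)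

lemma bids_mem (θ : (auction n m L U).Profile) (i : Fin n) : bids θ i ∈ Set.Icc L U :=
  Subtype.property (p := fun y : ℝ => y ∈ Set.Icc L U) (θ i)

lemma val_eq (θ : (auction n m L U).Profile) (i : Fin n) (d : (auction n m L U).Decision) :
    (auction n m L U).val i d (θ i) =
      if i ∈ (show {W : Finset (Fin n) // W.card ≤ m} from d).1 then bids θ i else 0 := rfl

/-- The type profile with prescribed real types. -/
def profileOf (x : Fin n → ℝ) (hx : ∀ i, x i ∈ Set.Icc L U) : (auction n m L U).Profile :=
  fun i => (⟨x i, hx i⟩ : Set.Icc L U)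

lemma bids_profileOf (x : Fin n → ℝ) (hx : ∀ i, x i ∈ Set.Icc L U) :
    bids (profileOf (m := m) x hx) = x := rfl

lemma card_filter_lt_le (x : Fin n → ℝ) (σ : Equiv.Perm (Fin n)) (hσ : Antitone (x ∘ σ))
    (hmn : m < n) (s : Finset (Fin n)) :
    (s.filter (fun j => x (σ ⟨m, hmn⟩) < x j)).card ≤ m := by
  have h : s.filter (fun j => x (σ ⟨m, hmn⟩) < x j) ⊆
      (Finset.Iio (⟨m, hmn⟩ : Fin n)).map σ.toEmbedding := by
    intro j hj
    rw [Finset.mem_map_equiv, Finset.mem_Iio]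
    by_contra hc
    have h2 : x (σ (σ.symm j)) ≤ x (σ ⟨m, hmn⟩) := hσ (not_lt.1 hc)
    rw [Equiv.apply_symm_apply] at h2
    exact absurd (Finset.mem_filter.1 hj).2 (not_lt.2 h2)
  simpa using Finset.card_le_card h

lemma succ_le_card_filter_le (x : Fin n → ℝ) (σ : Equiv.Perm (Fin n)) (hσ : Antitone (x ∘ σ))
    (hmn : m < n) :
    m + 1 ≤ (Finset.univ.filter (fun j => x (σ ⟨m, hmn⟩) ≤ x j)).card := by
  have h : (Finset.Iic (⟨m, hmn⟩ : Fin n)).map σ.toEmbedding ⊆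
      Finset.univ.filter (fun j => x (σ ⟨m, hmn⟩) ≤ x j) := by
    intro j hj
    rw [Finset.mem_map_equiv, Finset.mem_Iic] at hj
    have h2 : x (σ ⟨m, hmn⟩) ≤ x (σ (σ.symm j)) := hσ hj
    rw [Equiv.apply_symm_apply] at h2
    simpa using h2
  simpa using Finset.card_le_card h

/-- The best total value of the agents in `s`, provided that at least `m` of them value a unit at
least as much as the agent ranked `m + 1`. -/
lemma isGreatest_welfare (hL : 0 ≤ L) (hmn : m < n) (θ : (auction n m L U).Profile)
    (σ : Equiv.Perm (Fin n)) (hσ : Antitone (bids θ ∘ σ)) (s : Finset (Fin n))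
    (hs : m ≤ (s.filter (fun j => bids θ (σ ⟨m, hmn⟩) ≤ bids θ j)).card) :
    IsGreatest (Set.range fun d => ∑ j ∈ s, (auction n m L U).val j d (θ j))
      (∑ j ∈ s, max (bids θ j - bids θ (σ ⟨m, hmn⟩)) 0 + m * bids θ (σ ⟨m, hmn⟩)) := by
  constructor
  · obtain ⟨W, hWs, hW, hsum⟩ := exists_sum_eq_of_threshold s (bids θ) _ m
      (card_filter_lt_le _ σ hσ hmn s) hs
    refine ⟨(⟨W, hW.le⟩ : {W : Finset (Fin n) // W.card ≤ m}), ?_⟩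
    change ∑ j ∈ s, (if j ∈ W then bids θ j else 0) = _
    rw [← hsum, Finset.sum_ite_mem, Finset.inter_eq_right.2 hWs]
  · rintro _ ⟨d, rfl⟩
    simp only [val_eq]
    exact sum_le_of_card_le s _ _ _ (hL.trans (bids_mem θ _).1) m
      (show {W : Finset (Fin n) // W.card ≤ m} from d).2

/-- With `τ` the `(m+1)`-st highest type, the agents other than `i` can reach the total value
`∑_{j ≠ i} (θ_j - τ)⁺ + m τ`, whether or not `i` is among the highest `m`. -/
lemma iSup_othersWelfare (hL : 0 ≤ L) (hmn : m < n) (θ : (auction n m L U).Profile)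
    (σ : Equiv.Perm (Fin n)) (hσ : Antitone (bids θ ∘ σ)) (i : Fin n) :
    (⨆ d, DecisionProblem.othersWelfare i d θ) =
      ∑ j ∈ Finset.univ.erase i, max (bids θ j - bids θ (σ ⟨m, hmn⟩)) 0
        + m * bids θ (σ ⟨m, hmn⟩) := by
  refine (isGreatest_welfare hL hmn θ σ hσ (Finset.univ.erase i) ?_).csSup_eq
  rw [Finset.filter_erase]
  have h1 := succ_le_card_filter_le (bids θ) σ hσ hmn
  have h2 := Finset.pred_card_le_card_erase
    (s := Finset.univ.filter (fun j => bids θ (σ ⟨m, hmn⟩) ≤ bids θ j)) (a := i)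
  omega

lemma welfare_eq_of_efficient (hL : 0 ≤ L) (hmn : m < n) {M : Mechanism (auction n m L U)}
    (hM : M.Efficient) (θ : (auction n m L U).Profile)
    (σ : Equiv.Perm (Fin n)) (hσ : Antitone (bids θ ∘ σ)) :
    ∑ i, (auction n m L U).val i (M.f θ) (θ i) =
      ∑ j, max (bids θ j - bids θ (σ ⟨m, hmn⟩)) 0 + m * bids θ (σ ⟨m, hmn⟩) := by
  have h : IsGreatest (Set.range fun d => ∑ i, (auction n m L U).val i d (θ i))
      (∑ i, (auction n m L U).val i (M.f θ) (θ i)) :=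
    ⟨⟨M.f θ, rfl⟩, by rintro _ ⟨d, rfl⟩; exact hM θ d⟩
  exact h.unique (isGreatest_welfare hL hmn θ σ hσ Finset.univ
    ((Nat.le_succ m).trans (succ_le_card_filter_le _ σ hσ hmn)))

/-- In total the agents make a VCG payment of `m` times the `(m+1)`-st highest type. -/
lemma sum_vcgPayment (hL : 0 ≤ L) (hmn : m < n) {M : Mechanism (auction n m L U)}
    (hM : M.Efficient) (θ : (auction n m L U).Profile)
    (σ : Equiv.Perm (Fin n)) (hσ : Antitone (bids θ ∘ σ)) :
    ∑ i, M.vcgPayment θ i = m * bids θ (σ ⟨m, hmn⟩) := by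
  have hW := welfare_eq_of_efficient hL hmn hM θ σ hσ
  have h : ∀ i, M.vcgPayment θ i = (auction n m L U).val i (M.f θ) (θ i)
      - max (bids θ i - bids θ (σ ⟨m, hmn⟩)) 0 := by
    intro i
    -- Both maxima are dual values at the same price, so their difference is the term of agent `i`.
    rw [Mechanism.vcgPayment, iSup_othersWelfare hL hmn θ σ hσ i, DecisionProblem.othersWelfare,
      Finset.sum_erase_eq_sub (Finset.mem_univ i), Finset.sum_erase_eq_sub (Finset.mem_univ i), hW]
    ring
  simp_rw [h, Finset.sum_sub_distrib, hW]
  ring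

/-! ### The total payment under linear redistribution -/

/-- The total payment under the linear redistribution with coefficients `c`, in terms of the
sorted types `S 1 ≥ … ≥ S n`. -/
noncomputable def surplus (n m : ℕ) (c S : ℕ → ℝ) : ℝ :=
  m * S (m + 1) - n * c 0
    - ∑ j ∈ Finset.Icc 1 (n - 1), c j * (((n : ℝ) - j) * S j + j * S (j + 1))

lemma sum_payment (hL : 0 ≤ L) (hmn : m < n) {M : Mechanism (auction n m L U)}
    (hM : M.Efficient) {c : ℕ → ℝ} (hc : M.HasRedistribution (linearRedistribution c))
    (θ : (auction n m L U).Profile) (σ : Equiv.Perm (Fin n)) (hσ : Antitone (bids θ ∘ σ)) :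
    ∑ i, M.t θ i = surplus n m c (sorted L U (bids θ) σ) := by
  have h : ∀ i, linearRedistribution c i (DecisionProblem.others i θ) = c 0 +
      ∑ j ∈ Finset.Icc 1 (n - 1), c j * nthHighest (fun a : {a // a ≠ i} => bids θ a) j :=
    fun i => rfl
  simp_rw [fun i => hc θ i, h]
  rw [Finset.sum_sub_distrib, sum_vcgPayment hL hmn hM θ σ hσ, surplus, sorted_succ _ _ _ _ m hmn,
    Finset.sum_add_distrib, Finset.sum_comm]
  simp_rw [← Finset.mul_sum]
  rw [sub_sub]
  congr 2
  · simp
  · refine Finset.sum_congr rfl fun j hj => ?_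
    rw [Finset.mem_Icc] at hj
    rw [sum_nthHighest_others L U (bids θ) σ hσ j hj.1 (by omega)]

/-! ### Undominated mechanisms -/

/-- If the total payment stayed above `ε > 0` for all types of agent `i` against the types in
`θ` of the others, then agent `i` could be given `ε` more against these types. -/
lemma _root_.Mechanism.IndividuallyUndominated.exists_sum_lt {P : DecisionProblem n}
    {M : Mechanism P} (hM : M.IndividuallyUndominated) (hG : M.IsGroves) (hN : M.NonDeficit)
    (θ : P.Profile) (i : Fin n) {ε : ℝ} (hε : 0 < ε) :
    ∃ θ' : P.Profile, (∀ j, j ≠ i → θ' j = θ j) ∧ ∑ j, M.t θ' j < ε := by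
  classical
  by_contra! hc
  obtain ⟨hE, h, hh⟩ := hG
  -- `M'` differs from `M` only in giving agent `i` the amount `ε` when the others have types `θ`.
  let M' : Mechanism P :=
    { f := M.f
      t := fun η j => M.t η j - if j = i ∧ ∀ k, k ≠ i → η k = θ k then ε else 0 }
  refine hM M' ⟨hE, fun j x => h j x - if hj : j = i then
    (if x = P.others j θ then ε else 0) else 0, ?_⟩ ?_ ⟨?_, θ, i, ?_⟩
  · intro η j
    have hx : P.others j η = P.others j θ ↔ ∀ k, k ≠ j → η k = θ k := by
      rw [funext_iff]
      exact Subtype.forall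
    by_cases hj : j = i
    · subst hj
      simp only [M', hh η j, hx, dif_pos, true_and]
      ring
    · simp [M', hj, hh η j]
  · intro η
    by_cases hη : ∀ k, k ≠ i → η k = θ k
    · have h1 : ∑ j, M'.t η j = ∑ j, M.t η j - ε := by
        simp only [M', Finset.sum_sub_distrib, and_iff_left hη, Finset.sum_ite_eq',
          Finset.mem_univ, if_true]
      linarith [hc η hη]
    · simpa [M', hη] using hN η
  · intro η j
    simp only [Mechanism.utility, M']
    split_ifs <;> linarith
  · simpa [Mechanism.utility, M'] using hε

/-! ### The total payment at step profiles -/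

/-- The coefficient of the `j`-th highest type in the total payment `surplus n m c`,
for `1 ≤ j ≤ n`. The values `c n` (for `j = n`) and `c 0` (for `j = 1`) are multiplied by `0`. -/
noncomputable def slope (n m : ℕ) (c : ℕ → ℝ) (j : ℕ) : ℝ :=
  (if j = m + 1 then (m : ℝ) else 0) - ((n : ℝ) - j) * c j - ((j : ℝ) - 1) * c (j - 1)

lemma surplus_eq_slope {n m : ℕ} (hmn : m < n) (c S : ℕ → ℝ) :
    surplus n m c S = -(n * c 0) + ∑ j ∈ Finset.Icc 1 n, slope n m c j * S j := by
  obtain ⟨N, rfl⟩ : ∃ N, n = N + 1 := ⟨n - 1, by omega⟩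
  have h1 : ∑ j ∈ Finset.Icc 1 (N + 1), (if j = m + 1 then (m : ℝ) else 0) * S j =
      m * S (m + 1) := by
    simp_rw [ite_mul, zero_mul]
    rw [Finset.sum_ite_eq', if_pos (by simp; omega)]
  have h2 : ∑ j ∈ Finset.Icc 1 (N + 1), (((N + 1 : ℕ) : ℝ) - j) * c j * S j =
      ∑ j ∈ Finset.Icc 1 N, (((N + 1 : ℕ) : ℝ) - j) * c j * S j := by
    rw [Finset.sum_Icc_succ_top (by omega)]
    simp
  have h3 : ∑ j ∈ Finset.Icc 1 (N + 1), ((j : ℝ) - 1) * c (j - 1) * S j =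
      ∑ j ∈ Finset.Icc 1 N, (j : ℝ) * c j * S (j + 1) := by
    rw [← Finset.Ico_succ_right_eq_Icc, ← Finset.Ico_succ_right_eq_Icc,
      Finset.sum_eq_sum_Ico_succ_bot (by simp)]
    simp [← Finset.sum_Ico_add' (fun j : ℕ => ((j : ℝ) - 1) * c (j - 1) * S j) 1 (N + 1) 1]
  have h4 : ∑ j ∈ Finset.Icc 1 N, c j * ((((N + 1 : ℕ) : ℝ) - j) * S j + j * S (j + 1)) =
      ∑ j ∈ Finset.Icc 1 N, (((N + 1 : ℕ) : ℝ) - j) * c j * S j +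
        ∑ j ∈ Finset.Icc 1 N, (j : ℝ) * c j * S (j + 1) := by
    rw [← Finset.sum_add_distrib]
    exact Finset.sum_congr rfl fun j _ => by ring
  simp_rw [slope, sub_mul _ _ (S _), Finset.sum_sub_distrib]
  rw [h1, h2, h3, surplus, Nat.add_sub_cancel, h4]
  ring

/-- The profile with `k` types equal to `U` and the others equal to `L`, as a sorted vector. -/
noncomputable def step (L U : ℝ) (k j : ℕ) : ℝ := if j ≤ k then U else L

lemma surplus_step_succ_sub {n m : ℕ} (hmn : m < n) (c : ℕ → ℝ) (L U : ℝ) (k : ℕ) (hk : k < n) :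
    surplus n m c (step L U (k + 1)) - surplus n m c (step L U k) =
      (U - L) * slope n m c (k + 1) := by
  rw [surplus_eq_slope hmn, surplus_eq_slope hmn, add_sub_add_left_eq_sub, ← Finset.sum_sub_distrib,
    Finset.sum_eq_single (k + 1)]
  · simp [step]; ring
  · intro j _ hj
    have : j ≤ k + 1 ↔ j ≤ k := by omega
    simp [step, this]
  · intro h
    exact absurd (Finset.mem_Icc.2 ⟨by omega, by omega⟩) h

lemma surplus_const {n m : ℕ} (c S : ℕ → ℝ) (hmn : m < n) (x : ℝ)
    (hS : ∀ j, 1 ≤ j → j ≤ n → S j = x) :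
    surplus n m c S = m * x - n * (c 0 + x * ∑ j ∈ Finset.Icc 1 (n - 1), c j) := by
  rw [surplus, hS (m + 1) (by omega) (by omega), mul_add, Finset.mul_sum, Finset.mul_sum, sub_sub]
  congr 2
  refine Finset.sum_congr rfl fun j hj => ?_
  rw [Finset.mem_Icc] at hj
  rw [hS j (by omega) (by omega), hS (j + 1) (by omega) (by omega)]
  ring

/-- A sorted vector between `L` and `U` is a convex combination of the step vectors, the weights
being proportional to its gaps. -/
lemma surplus_eq_sum_gap {n m : ℕ} (hmn : m < n) (c S : ℕ → ℝ) (L U : ℝ) (h0 : S 0 = U)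
    (hn : S (n + 1) = L) :
    (U - L) * surplus n m c S =
      ∑ k ∈ Finset.range (n + 1), (S k - S (k + 1)) * surplus n m c (step L U k) := by
  -- Summation by parts: the differences of `V` are multiples of the slopes.
  set V := fun k => surplus n m c (step L U k) with hV
  have habel : ∀ N : ℕ, ∑ k ∈ Finset.range (N + 1), (S k - S (k + 1)) * V k =
      S 0 * V 0 - S (N + 1) * V N + ∑ k ∈ Finset.range N, (V (k + 1) - V k) * S (k + 1) := by
    intro N
    induction N with
    | zero => simp; ring
    | succ N ih => rw [Finset.sum_range_succ, ih, Finset.sum_range_succ]; ring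
  rw [habel, h0, hn]
  have h1 : ∑ k ∈ Finset.range n, (V (k + 1) - V k) * S (k + 1) =
      (U - L) * ∑ j ∈ Finset.Icc 1 n, slope n m c j * S j := by
    have hshift : ∑ j ∈ Finset.Icc 1 n, slope n m c j * S j =
        ∑ k ∈ Finset.range n, slope n m c (k + 1) * S (k + 1) := by
      rw [Finset.range_eq_Ico, Finset.sum_Ico_add' (fun j => slope n m c j * S j) 0 n 1]
      rfl
    rw [hshift, Finset.mul_sum]
    refine Finset.sum_congr rfl fun k hk => ?_
    rw [hV]
    simp only
    rw [surplus_step_succ_sub hmn c L U k (Finset.mem_range.1 hk)]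
    ring
  rw [h1, surplus_eq_slope hmn c S]
  have h2 : V 0 = -(n * c 0) + L * ∑ j ∈ Finset.Icc 1 n, slope n m c j := by
    rw [hV]; simp only; rw [surplus_eq_slope hmn, Finset.mul_sum]
    congr 1
    refine Finset.sum_congr rfl fun j hj => ?_
    rw [Finset.mem_Icc] at hj
    rw [step, if_neg (by omega), mul_comm]
  have h3 : V n = -(n * c 0) + U * ∑ j ∈ Finset.Icc 1 n, slope n m c j := by
    rw [hV]; simp only; rw [surplus_eq_slope hmn, Finset.mul_sum]
    congr 1
    refine Finset.sum_congr rfl fun j hj => ?_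
    rw [Finset.mem_Icc] at hj
    rw [step, if_pos (by omega), mul_comm]
  rw [h2, h3]
  ring

/-! ### Recurrences for the OEL coefficients -/

lemma lowCoeff_self (n : ℕ) {m : ℕ} : lowCoeff n m m = 1 := by
  rw [lowCoeff, show n - m - 1 = n - (m + 1) by omega]; simp

lemma lowCoeff_rec {n m j : ℕ} (hj : 1 ≤ j) (hjm : j < m) (hmn : m < n) :
    (j : ℝ) * lowCoeff n m j = -(((n : ℝ) - (j + 1 : ℕ)) * lowCoeff n m (j + 1)) := by
  obtain ⟨i, rfl⟩ := Nat.exists_eq_add_of_le' hj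
  obtain ⟨a, rfl⟩ := Nat.exists_eq_add_of_lt hjm
  obtain ⟨b, rfl⟩ := Nat.exists_eq_add_of_lt hmn
  have e1 : i + 1 + a + 1 + b + 1 - (i + 1) - 1 = a + b + 1 := by omega
  have e2 : i + 1 + a + 1 + b + 1 - (i + 1 + a + 1) - 1 = b := by omega
  have e3 : i + 1 + a + 1 - 1 = i + a + 1 := by omega
  have e4 : i + 1 + a + 1 + b + 1 - (i + 1 + 1) - 1 = a + b := by omega
  have hX := Nat.choose_mul_succ_eq (a + b) b
  rw [show a + b + 1 - b = a + 1 by omega] at hX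
  have hY := Nat.choose_succ_right_eq (i + a + 1) i
  rw [show i + a + 1 - i = a + 1 by omega] at hY
  have hp1 : (0 : ℝ) < ((i + a + 1).choose i : ℝ) := by
    exact_mod_cast Nat.choose_pos (by omega)
  have hp2 : (0 : ℝ) < ((i + a + 1).choose (i + 1) : ℝ) := by
    exact_mod_cast Nat.choose_pos (by omega)
  have hz : ((-1 : ℝ)) ^ (((i + 1 + a + 1 : ℕ) : ℤ) - ((i + 1 : ℕ) : ℤ)) =
      -(-1) ^ (((i + 1 + a + 1 : ℕ) : ℤ) - ((i + 1 + 1 : ℕ) : ℤ)) := by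
    rw [show ((i + 1 + a + 1 : ℕ) : ℤ) - ((i + 1 : ℕ) : ℤ) =
      (((i + 1 + a + 1 : ℕ) : ℤ) - ((i + 1 + 1 : ℕ) : ℤ)) + 1 by push_cast; ring,
      zpow_add_one₀ (by norm_num)]
    ring
  simp only [lowCoeff, e1, e2, e3, e4, hz, Nat.add_sub_cancel]
  generalize (-1 : ℝ) ^ (((i + 1 + a + 1 : ℕ) : ℤ) - ((i + 1 + 1 : ℕ) : ℤ)) = w
  have hX' : ((a + b).choose b : ℝ) * (a + b + 1) = (a + b + 1).choose b * (a + 1) := by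
    exact_mod_cast hX
  have hY' : ((i + a + 1).choose (i + 1) : ℝ) * (i + 1) = (i + a + 1).choose i * (a + 1) := by
    exact_mod_cast hY
  push_cast
  field_simp
  linear_combination (-w * ((a + b + 1).choose b : ℝ)) * hY' + w * ((i + a + 1).choose i : ℝ) * hX'

lemma highCoeff_first {n m : ℕ} (hm : 1 ≤ m) (hmn : m + 1 < n) :
    ((n : ℝ) - (m + 1 : ℕ)) * highCoeff n m (m + 1) = m := by
  obtain ⟨p, rfl⟩ := Nat.exists_eq_add_of_le' hm
  obtain ⟨b, rfl⟩ := Nat.exists_eq_add_of_lt hmn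
  rw [highCoeff, show p + 1 + 1 + b + 1 - (p + 1) - 1 = b + 1 by omega,
    show p + 1 + 1 + b + 1 - (p + 1 + 1) - 1 = b by omega,
    show ((p + 1 : ℕ) : ℤ) - ((p + 1 + 1 : ℕ) : ℤ) - 1 = -2 by push_cast; ring]
  simp only [Nat.add_sub_cancel, Nat.choose_succ_self_right]
  push_cast
  have : (b : ℝ) + 1 ≠ 0 := by positivity
  field_simp
  ring

lemma highCoeff_rec {n m j : ℕ} (hm : 1 ≤ m) (hj : m + 1 ≤ j) (hjn : j + 1 < n) :
    ((n : ℝ) - (j + 1 : ℕ)) * highCoeff n m (j + 1) = -((j : ℝ) * highCoeff n m j) := by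
  obtain ⟨p, rfl⟩ := Nat.exists_eq_add_of_le' hm
  obtain ⟨a, rfl⟩ := Nat.exists_eq_add_of_le hj
  obtain ⟨b, rfl⟩ := Nat.exists_eq_add_of_lt hjn
  have e1 : p + 1 + 1 + a + 1 + b + 1 - (p + 1) - 1 = a + b + 2 := by omega
  have e2 : p + 1 + 1 + a + 1 + b + 1 - (p + 1 + 1 + a + 1) - 1 = b := by omega
  have e3 : p + 1 + 1 + a + 1 + b + 1 - (p + 1 + 1 + a) - 1 = b + 1 := by omega
  have e4 : p + 1 + 1 + a + 1 - 1 = p + a + 2 := by omega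
  have e5 : p + 1 + 1 + a - 1 = p + a + 1 := by omega
  have hX := Nat.choose_mul_succ_eq (p + a + 1) p
  rw [show p + a + 1 + 1 - p = a + 2 by omega] at hX
  have hY := Nat.choose_succ_right_eq (a + b + 2) b
  rw [show a + b + 2 - b = a + 2 by omega] at hY
  have hp1 : (0 : ℝ) < ((a + b + 2).choose b : ℝ) := by
    exact_mod_cast Nat.choose_pos (by omega)
  have hp2 : (0 : ℝ) < ((a + b + 2).choose (b + 1) : ℝ) := by
    exact_mod_cast Nat.choose_pos (by omega)
  have hz : ((-1 : ℝ)) ^ (((p + 1 : ℕ) : ℤ) - ((p + 1 + 1 + a : ℕ) : ℤ) - 1) =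
      -(-1) ^ (((p + 1 : ℕ) : ℤ) - ((p + 1 + 1 + a + 1 : ℕ) : ℤ) - 1) := by
    rw [show ((p + 1 : ℕ) : ℤ) - ((p + 1 + 1 + a : ℕ) : ℤ) - 1 =
      (((p + 1 : ℕ) : ℤ) - ((p + 1 + 1 + a + 1 : ℕ) : ℤ) - 1) + 1 by push_cast; ring,
      zpow_add_one₀ (by norm_num)]
    ring
  simp only [highCoeff, e1, e2, e3, e4, e5, hz, Nat.add_sub_cancel]
  generalize (-1 : ℝ) ^ (((p + 1 : ℕ) : ℤ) - ((p + 1 + 1 + a + 1 : ℕ) : ℤ) - 1) = w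
  have hX' : ((p + a + 1).choose p : ℝ) * (p + a + 2) = (p + a + 2).choose p * (a + 2) := by
    have := congrArg (Nat.cast (R := ℝ)) hX
    push_cast at this
    linear_combination this
  have hY' : ((a + b + 2).choose (b + 1) : ℝ) * (b + 1) = (a + b + 2).choose b * (a + 2) := by
    exact_mod_cast hY
  push_cast
  field_simp
  linear_combination w * ((p + a + 2).choose p : ℝ) * hY' - w * ((a + b + 2).choose b : ℝ) * hX'

lemma odd_of_lowCoeff_pos {n m j : ℕ} (h : 0 < lowCoeff n m (j + 1)) :
    Odd ((j : ℤ) - m) := by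
  by_contra hc
  rw [Int.not_odd_iff_even] at hc
  obtain ⟨r, hr⟩ := hc
  have h1 : Odd ((m : ℤ) - (j + 1 : ℕ)) := ⟨-r - 1, by push_cast; omega⟩
  rw [lowCoeff, h1.neg_one_zpow] at h
  have : (0 : ℝ) ≤
      ((n - (j + 1) - 1).choose (n - m - 1) : ℝ) / ((m - 1).choose (j + 1 - 1) : ℝ) := by
    positivity
  rw [neg_one_mul, neg_div] at h
  linarith

lemma odd_of_highCoeff_neg {n m j : ℕ} (h : highCoeff n m j < 0) :
    Odd (((j + 1 : ℕ) : ℤ) - m) := by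
  by_contra hc
  rw [Int.not_odd_iff_even] at hc
  obtain ⟨r, hr⟩ := hc
  have h1 : Even ((m : ℤ) - j - 1) := ⟨-r, by push_cast at hr; omega⟩
  rw [highCoeff, h1.neg_one_zpow] at h
  have : (0 : ℝ) ≤ ((j - 1).choose (m - 1) : ℝ) / ((n - m - 1).choose (n - j - 1) : ℝ) := by
    positivity
  rw [one_mul] at h
  linarith

variable {c : ℕ → ℝ}

/-! ### Solving the recurrences -/

lemma slope_of_ne {j : ℕ} (hj : j ≠ m + 1) :
    slope n m c j = -(((n : ℝ) - j) * c j) - ((j : ℝ) - 1) * c (j - 1) := by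
  rw [slope, if_neg hj]; ring

/-- Forward recursion from `c 1`, where `slope` involves no other coefficient. -/
lemma eq_zero_of_slope_eq_zero_below {k : ℕ} (hk : k ≤ m + 1) (hkn : k ≤ n)
    (h : ∀ j, 1 ≤ j → j < k → slope n m c j = 0) :
    ∀ j, 1 ≤ j → j < k → c j = 0 := by
  intro j hj
  induction j, hj using Nat.le_induction with
  | base =>
    intro h1
    have h2 := h 1 le_rfl h1
    rw [slope_of_ne (by omega)] at h2
    have h3 : (1 : ℝ) < n := by exact_mod_cast (by omega : 1 < n)
    have h4 : ((n : ℝ) - 1) * c 1 = 0 := by push_cast at h2; linarith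
    exact (mul_eq_zero.1 h4).resolve_left (by linarith)
  | succ j hj ih =>
    intro h1
    have h2 := h (j + 1) (by omega) h1
    rw [slope_of_ne (by omega), Nat.add_sub_cancel, ih (by omega)] at h2
    have h3 : ((j + 1 : ℕ) : ℝ) < n := by exact_mod_cast (by omega : j + 1 < n)
    have h4 : ((n : ℝ) - (j + 1 : ℕ)) * c (j + 1) = 0 := by linarith
    exact (mul_eq_zero.1 h4).resolve_left (by linarith)

/-- Backward recursion from `c (n - 1)`, the only coefficient in the slope at `n`. -/
lemma eq_zero_of_slope_eq_zero_above {k : ℕ} (hk : m ≤ k)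
    (h : ∀ j, k + 1 < j → j ≤ n → slope n m c j = 0) :
    ∀ j, k < j → j < n → c j = 0 := by
  intro j hj hjn
  obtain ⟨d, hd⟩ := Nat.exists_eq_add_of_lt hjn
  induction d generalizing j with
  | zero =>
    have h2 := h n (by omega) le_rfl
    rw [slope_of_ne (by omega), show n - 1 = j by omega, sub_self] at h2
    have h3 : (1 : ℝ) < n := by exact_mod_cast (by omega : 1 < n)
    have h4 : ((n : ℝ) - 1) * c j = 0 := by linarith
    exact (mul_eq_zero.1 h4).resolve_left (by linarith)
  | succ d ih =>
    have h1 := ih (j + 1) (by omega) (by omega) (by omega)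
    have h2 := h (j + 1) (by omega) (by omega)
    rw [slope_of_ne (by omega), Nat.add_sub_cancel, h1] at h2
    have h3 : (0 : ℝ) < j := by exact_mod_cast (by omega : 0 < j)
    have h4 : (j : ℝ) * c j = 0 := by push_cast at h2; linarith
    exact (mul_eq_zero.1 h4).resolve_left (by linarith)

/-- Backward recursion from the slope at `m + 1`, which contains the VCG payments and gives
`c m = 1`. -/
lemma eq_lowCoeff_of_slope_eq_zero {k : ℕ} (hmn : m < n) (hm : 1 ≤ m)
    (hc : m + 1 < n → c (m + 1) = 0)
    (h : ∀ j, k + 1 < j → j ≤ m + 1 → slope n m c j = 0) :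
    ∀ j, k < j → j ≤ m → 1 ≤ j → c j = lowCoeff n m j := by
  intro j hj hjm hj1
  obtain ⟨d, hd⟩ := Nat.exists_eq_add_of_le hjm
  induction d generalizing j with
  | zero =>
    obtain rfl : j = m := by omega
    have h2 := h (j + 1) (by omega) le_rfl
    have h5 : ((n : ℝ) - (j + 1 : ℕ)) * c (j + 1) = 0 := by
      rcases Nat.lt_or_ge (j + 1) n with h6 | h6
      · rw [hc h6, mul_zero]
      · obtain rfl : n = j + 1 := by omega
        rw [sub_self, zero_mul]
    rw [slope, if_pos rfl, h5, Nat.add_sub_cancel] at h2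
    have h3 : (0 : ℝ) < j := by exact_mod_cast hm
    rw [lowCoeff_self]
    refine mul_left_cancel₀ h3.ne' ?_
    push_cast at h2
    linarith
  | succ d ih =>
    have h1 := ih (j + 1) (by omega) (by omega) (by omega) (by omega)
    have h2 := h (j + 1) (by omega) (by omega)
    rw [slope_of_ne (by omega), Nat.add_sub_cancel, h1] at h2
    have h3 : (0 : ℝ) < j := by exact_mod_cast hj1
    refine mul_left_cancel₀ h3.ne' ?_
    rw [lowCoeff_rec hj1 (by omega) hmn]
    push_cast at h2 ⊢
    linarith

/-- Forward recursion from the slope at `m + 1`, which contains the VCG payments and gives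
`(n - m - 1) * c (m + 1) = m`. -/
lemma eq_highCoeff_of_slope_eq_zero {k : ℕ} (hm : 1 ≤ m) (hkn : k ≤ n) (hc : c m = 0)
    (h : ∀ j, m < j → j < k → slope n m c j = 0) :
    ∀ j, m + 1 ≤ j → j < k → c j = highCoeff n m j := by
  intro j hj
  induction j, hj using Nat.le_induction with
  | base =>
    intro h1
    have h2 := h (m + 1) (by omega) h1
    rw [slope, if_pos rfl, Nat.add_sub_cancel, hc,
      ← highCoeff_first hm (by omega : m + 1 < n)] at h2
    have h3 : ((m + 1 : ℕ) : ℝ) < n := by exact_mod_cast (by omega : m + 1 < n)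
    refine mul_left_cancel₀ (sub_pos.2 h3).ne' ?_
    linarith
  | succ j hj ih =>
    intro h1
    have h2 := h (j + 1) (by omega) h1
    rw [slope_of_ne (by omega), Nat.add_sub_cancel, ih (by omega)] at h2
    have h3 : ((j + 1 : ℕ) : ℝ) < n := by exact_mod_cast (by omega : j + 1 < n)
    refine mul_left_cancel₀ (sub_pos.2 h3).ne' ?_
    rw [highCoeff_rec hm hj (by omega)]
    push_cast at h2 ⊢
    linarith

lemma sum_Icc_eq_sum_Icc {N a b : ℕ} {g : ℕ → ℝ} (ha : 1 ≤ a) (hb : b ≤ N)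
    (h1 : ∀ j, 1 ≤ j → j < a → c j = 0) (h2 : ∀ j, b < j → j ≤ N → c j = 0)
    (h : ∀ j, a ≤ j → j ≤ b → c j = g j) :
    ∑ j ∈ Finset.Icc 1 N, c j = ∑ j ∈ Finset.Icc a b, g j := by
  rw [← Finset.sum_subset (Finset.Icc_subset_Icc ha hb)]
  · exact Finset.sum_congr rfl fun j hj => h j (Finset.mem_Icc.1 hj).1 (Finset.mem_Icc.1 hj).2
  · intro j hj hj'
    rw [Finset.mem_Icc] at hj hj'
    rcases Nat.lt_or_ge j a with h3 | h3
    · exact h1 j hj.1 h3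
    · exact h2 j (by omega) hj.2

/-! ### A single nonzero step value determines the coefficients -/

section Steps

variable {k : ℕ}

lemma slope_eq_zero_of_surplus_step (hLU : L < U) (hmn : m < n)
    (hzero : ∀ i, i ≤ n → i ≠ k → surplus n m c (step L U i) = 0) {j : ℕ} (hj : 1 ≤ j)
    (hjn : j ≤ n) (hjk : j ≠ k) (hjk' : j ≠ k + 1) : slope n m c j = 0 := by
  obtain ⟨j, rfl⟩ := Nat.exists_eq_add_of_le' hj
  have h := surplus_step_succ_sub hmn c L U j (by omega)
  rw [hzero (j + 1) hjn hjk, hzero j (by omega) (by omega), sub_zero] at h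
  exact (mul_eq_zero.1 h.symm).resolve_left (sub_pos.2 hLU).ne'

lemma slope_self_of_surplus_step (hmn : m < n)
    (hzero : ∀ i, i ≤ n → i ≠ k → surplus n m c (step L U i) = 0) (hk : 1 ≤ k) (hkn : k ≤ n) :
    (U - L) * slope n m c k = surplus n m c (step L U k) := by
  obtain ⟨k, rfl⟩ := Nat.exists_eq_add_of_le' hk
  rw [← surplus_step_succ_sub hmn c L U k (by omega), hzero k (by omega) (by omega), sub_zero]

lemma slope_succ_of_surplus_step (hmn : m < n)
    (hzero : ∀ i, i ≤ n → i ≠ k → surplus n m c (step L U i) = 0) (hkn : k < n) :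
    (U - L) * slope n m c (k + 1) = -surplus n m c (step L U k) := by
  rw [← surplus_step_succ_sub hmn c L U k hkn, hzero (k + 1) (by omega) (by omega), zero_sub]

/-- At the constant profile `L`, the total payment is `m L - n (c_0 + L ∑_j c_j)`. -/
lemma coeff_zero_of_surplus_step_zero (hmn : m < n) (h : surplus n m c (step L U 0) = 0) :
    c 0 = L * m / n - L * ∑ j ∈ Finset.Icc 1 (n - 1), c j := by
  rw [surplus_const c (step L U 0) hmn L (fun j hj _ => if_neg (by omega))] at h
  have hn : (n : ℝ) ≠ 0 := by exact_mod_cast (by omega : n ≠ 0)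
  field_simp
  linarith

lemma coeff_zero_of_surplus_step_top (hmn : m < n) (h : surplus n m c (step L U n) = 0) :
    c 0 = U * m / n - U * ∑ j ∈ Finset.Icc 1 (n - 1), c j := by
  rw [surplus_const c (step L U n) hmn U (fun j _ hj => if_pos hj)] at h
  have hn : (n : ℝ) ≠ 0 := by exact_mod_cast (by omega : n ≠ 0)
  field_simp
  linarith

lemma sum_coeff_of_surplus_step (hLU : L < U) (hmn : m < n)
    (hzero : ∀ i, i ≤ n → i ≠ k → surplus n m c (step L U i) = 0) (hk : 1 ≤ k) (hkn : k < n) :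
    c 0 = 0 ∧ ∑ j ∈ Finset.Icc 1 (n - 1), c j = m / n := by
  have h1 := coeff_zero_of_surplus_step_zero hmn (hzero 0 (by omega) (by omega))
  have h2 := coeff_zero_of_surplus_step_top hmn (hzero n le_rfl (by omega))
  have h3 : (U - L) * (m / n - ∑ j ∈ Finset.Icc 1 (n - 1), c j) = 0 := by
    rw [mul_sub, sub_mul, sub_mul, ← mul_div_assoc, ← mul_div_assoc]; linarith
  have h4 := (mul_eq_zero.1 h3).resolve_left (sub_pos.2 hLU).ne'
  have h5 : ∑ j ∈ Finset.Icc 1 (n - 1), c j = m / n := by linarith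
  refine ⟨?_, h5⟩
  rw [h1, h5]; ring

/-- The total payment cannot vanish at all step profiles other than the `m`-th: the only
nonzero coefficient would be `c m = m / n`, which makes a deficit at the `m`-th step. -/
lemma surplus_step_neg (hLU : L < U) (hm : 1 ≤ m) (hmn : m < n)
    (hzero : ∀ i, i ≤ n → i ≠ m → surplus n m c (step L U i) = 0) :
    surplus n m c (step L U m) < 0 := by
  obtain ⟨-, hsum⟩ := sum_coeff_of_surplus_step hLU hmn hzero hm hmn
  have hlow := eq_zero_of_slope_eq_zero_below (c := c) (by omega : m ≤ m + 1) hmn.le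
    fun j h1 h2 => slope_eq_zero_of_surplus_step hLU hmn hzero h1 (by omega) (by omega) (by omega)
  have hhigh := eq_zero_of_slope_eq_zero_above (c := c) (n := n) (le_refl m)
    fun j h1 h2 => slope_eq_zero_of_surplus_step hLU hmn hzero (by omega) h2 (by omega) (by omega)
  rw [sum_Icc_eq_sum_Icc hm (by omega : m ≤ n - 1) hlow
    (fun j h1 h2 => hhigh j h1 (by omega)) (g := c) (fun _ _ _ => rfl), Finset.Icc_self,
    Finset.sum_singleton] at hsum
  rw [← slope_self_of_surplus_step hmn hzero hm hmn.le, slope_of_ne (by omega)]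
  have hmR : (0 : ℝ) < m := by exact_mod_cast hm
  have hmnR : (m : ℝ) < n := by exact_mod_cast hmn
  have h1 : ((m : ℝ) - 1) * c (m - 1) = 0 := by
    rcases Nat.lt_or_ge 1 m with h | h
    · rw [hlow (m - 1) (by omega) (by omega), mul_zero]
    · obtain rfl : m = 1 := by omega
      simp
  rw [h1, sub_zero, hsum]
  have h2 : 0 < ((n : ℝ) - m) * (m / n) :=
    mul_pos (sub_pos.2 hmnR) (div_pos hmR (hmR.trans hmnR))
  nlinarith [mul_pos (sub_pos.2 hLU) h2]

lemma eq_oelCoeff_zero (hLU : L < U) (hm : 1 ≤ m) (hmn : m < n)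
    (hpos : 0 < surplus n m c (step L U 0))
    (hzero : ∀ i, i ≤ n → i ≠ 0 → surplus n m c (step L U i) = 0) :
    Odd (((0 : ℕ) : ℤ) - m) ∧ ∀ j, j < n → c j = oelCoeff n m L U 0 j := by
  have hE : ∀ j, 1 < j → j ≤ n → slope n m c j = 0 := fun j h1 h2 =>
    slope_eq_zero_of_surplus_step hLU hmn hzero (by omega) h2 (by omega) (by omega)
  have hhigh := eq_zero_of_slope_eq_zero_above (c := c) (le_refl m)
    fun j h1 h2 => hE j (by omega) h2
  have hlow := eq_lowCoeff_of_slope_eq_zero (k := 0) hmn hm (fun h => hhigh _ (by omega) h)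
    fun j h1 h2 => hE j (by omega) (by omega)
  have h1 := slope_succ_of_surplus_step hmn hzero (by omega)
  refine ⟨odd_of_lowCoeff_pos (n := n) ?_, ?_⟩
  · rw [← hlow 1 (by omega) hm le_rfl]
    rw [slope_of_ne (by omega)] at h1
    push_cast at h1
    have h2 : (1 : ℝ) < n := by exact_mod_cast (by omega : 1 < n)
    have h3 : 0 < (U - L) * ((n - 1) * c 1) := by linear_combination hpos + h1
    exact pos_of_mul_pos_right (pos_of_mul_pos_right h3 (sub_pos.2 hLU).le) (by linarith)
  · intro j hj
    rw [oelCoeff, if_pos rfl]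
    split_ifs with h2 h3
    · rw [h2, coeff_zero_of_surplus_step_top hmn (hzero n le_rfl (by omega)),
        sum_Icc_eq_sum_Icc le_rfl (by omega : m ≤ n - 1) (fun j _ _ => by omega)
          (fun j h1 h2 => hhigh j h1 (by omega)) (fun j h1 h2 => hlow j (by omega) h2 h1)]
    · exact hlow j (by omega) h3 (by omega)
    · exact hhigh j (by omega) hj

lemma eq_oelCoeff_low (hLU : L < U) (hm : 1 ≤ m) (hmn : m < n) (hk : 1 ≤ k) (hkm : k < m)
    (hpos : 0 < surplus n m c (step L U k))
    (hzero : ∀ i, i ≤ n → i ≠ k → surplus n m c (step L U i) = 0) :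
    Odd ((k : ℤ) - m) ∧ ∀ j, j < n → c j = oelCoeff n m L U k j := by
  have hE : ∀ j, 1 ≤ j → j ≤ n → j ≠ k → j ≠ k + 1 → slope n m c j = 0 := fun j h1 h2 =>
    slope_eq_zero_of_surplus_step hLU hmn hzero h1 h2
  have hhigh := eq_zero_of_slope_eq_zero_above (c := c) (le_refl m)
    fun j h1 h2 => hE j (by omega) h2 (by omega) (by omega)
  have hlow := eq_lowCoeff_of_slope_eq_zero (k := k) hmn hm (fun h => hhigh _ (by omega) h)
    fun j h1 h2 => hE j (by omega) (by omega) (by omega) (by omega)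
  have hbelow := eq_zero_of_slope_eq_zero_below (c := c) (by omega : k ≤ m + 1)
    (by omega : k ≤ n) fun j h1 h2 => hE j h1 (by omega) (by omega) (by omega)
  obtain ⟨hc0, hsum⟩ := sum_coeff_of_surplus_step hLU hmn hzero hk (by omega)
  have h1 := slope_self_of_surplus_step hmn hzero hk (by omega)
  have h2 := slope_succ_of_surplus_step hmn hzero (by omega)
  have hUL : 0 < U - L := sub_pos.2 hLU
  rw [slope_of_ne (by omega)] at h1 h2
  refine ⟨odd_of_lowCoeff_pos (n := n) ?_, ?_⟩
  · rw [← hlow (k + 1) (by omega) (by omega) (by omega)]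
    have h3 : ((k : ℝ) - 1) * c (k - 1) = 0 := by
      rcases Nat.lt_or_ge 1 k with h | h
      · rw [hbelow (k - 1) (by omega) (by omega), mul_zero]
      · obtain rfl : k = 1 := by omega
        simp
    have hkn : ((k + 1 : ℕ) : ℝ) < n := by exact_mod_cast (by omega : k + 1 < n)
    have hk0 : (0 : ℝ) < k := by exact_mod_cast hk
    rw [h3] at h1
    -- The slope at `k` is positive, so `c k < 0`; the slope at `k + 1` is negative, and this makes
    -- `c (k + 1)` positive.
    have h4 : 0 < -c k := by
      refine pos_of_mul_pos_right (pos_of_mul_pos_right (a := U - L) (b := (n - k) * -c k) ?_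
        hUL.le) (by push_cast at hkn; linarith)
      linear_combination hpos - h1
    rw [Nat.add_sub_cancel] at h2
    have h5 : 0 < ((n : ℝ) - (k + 1 : ℕ)) * c (k + 1) + k * c k := by
      refine pos_of_mul_pos_right (a := U - L) ?_ hUL.le
      push_cast at h2 ⊢
      linear_combination hpos + h2
    exact pos_of_mul_pos_right (a := (n : ℝ) - (k + 1 : ℕ))
      (by linarith [mul_pos hk0 h4]) (sub_pos.2 hkn).le
  · intro j hj
    rw [oelCoeff, if_neg (by omega), if_pos hkm.le]
    split_ifs with h3 h4
    · have h5 : ∑ j ∈ Finset.Icc 1 (n - 1), c j = ∑ j ∈ Finset.Icc k m, c j :=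
        sum_Icc_eq_sum_Icc hk (by omega) hbelow (fun j h1 h2 => hhigh j h1 (by omega))
          (fun _ _ _ => rfl)
      rw [← hsum, h5, h3, ← Finset.add_sum_Ioc_eq_sum_Icc hkm.le]
      have h6 : ∑ j ∈ Finset.Ioc k m, c j = ∑ j ∈ Finset.Icc (k + 1) m, lowCoeff n m j := by
        refine Finset.sum_congr (by ext; simp) fun j hj => ?_
        rw [Finset.mem_Icc] at hj
        exact hlow j (by omega) hj.2 (by omega)
      rw [h6]; ring
    · exact hlow j (by omega) h4.2 (by omega)
    · rcases Nat.eq_zero_or_pos j with rfl | hj0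
      · exact hc0
      · rcases Nat.lt_or_ge j k with h5 | h5
        · exact hbelow j hj0 h5
        · exact hhigh j (by omega) hj

/-- For `k > m` the sign of `c (k - 1)`, the last coefficient that is a `highCoeff`, forces the
parity of `k - m`. -/
lemma odd_sub_of_slope_pos (hmk : m < k) (hck : 0 ≤ ((n : ℝ) - k) * c k)
    (hhigh : ∀ j, m + 1 ≤ j → j < k → c j = highCoeff n m j) (hpos : 0 < slope n m c k) :
    Odd ((k : ℤ) - m) := by
  rcases Nat.lt_or_ge (m + 1) k with h | h
  · obtain ⟨j, rfl⟩ : ∃ j, k = j + 1 := ⟨k - 1, by omega⟩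
    apply odd_of_highCoeff_neg (n := n)
    rw [slope_of_ne (by omega), Nat.add_sub_cancel, hhigh j (by omega) (by omega)] at hpos
    have hj : (0 : ℝ) < j := by exact_mod_cast (by omega : 0 < j)
    push_cast at hpos hck
    by_contra! hc
    linarith [mul_nonneg hj.le hc]
  · obtain rfl : k = m + 1 := by omega
    exact ⟨0, by push_cast; ring⟩

lemma eq_oelCoeff_high (hLU : L < U) (hm : 1 ≤ m) (hmn : m < n) (hmk : m < k) (hkn : k < n)
    (hpos : 0 < surplus n m c (step L U k))
    (hzero : ∀ i, i ≤ n → i ≠ k → surplus n m c (step L U i) = 0) :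
    Odd ((k : ℤ) - m) ∧ ∀ j, j < n → c j = oelCoeff n m L U k j := by
  have hE : ∀ j, 1 ≤ j → j ≤ n → j ≠ k → j ≠ k + 1 → slope n m c j = 0 := fun j h1 h2 =>
    slope_eq_zero_of_surplus_step hLU hmn hzero h1 h2
  have habove := eq_zero_of_slope_eq_zero_above (c := c) hmk.le
    fun j h1 h2 => hE j (by omega) h2 (by omega) (by omega)
  have hbelow := eq_zero_of_slope_eq_zero_below (c := c) (le_refl (m + 1))
    (by omega : m + 1 ≤ n) fun j h1 h2 => hE j h1 (by omega) (by omega) (by omega)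
  have hhigh := eq_highCoeff_of_slope_eq_zero (c := c) hm hkn.le (hbelow m hm (by omega))
    fun j h1 h2 => hE j (by omega) (by omega) (by omega) (by omega)
  obtain ⟨hc0, hsum⟩ := sum_coeff_of_surplus_step hLU hmn hzero (by omega) hkn
  have h1 := slope_self_of_surplus_step hmn hzero (by omega) hkn.le
  have h2 := slope_succ_of_surplus_step hmn hzero hkn
  have hUL : 0 < U - L := sub_pos.2 hLU
  refine ⟨odd_sub_of_slope_pos hmk ?_ hhigh
    (pos_of_mul_pos_right (h1 ▸ hpos) hUL.le), ?_⟩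
  · rw [slope_of_ne (by omega), Nat.add_sub_cancel] at h2
    have h3 : ((n : ℝ) - (k + 1 : ℕ)) * c (k + 1) = 0 := by
      rcases Nat.lt_or_ge (k + 1) n with h | h
      · rw [habove (k + 1) (by omega) h, mul_zero]
      · obtain rfl : n = k + 1 := by omega
        rw [sub_self, zero_mul]
    rw [h3] at h2
    have hk0 : (0 : ℝ) < k := by exact_mod_cast (by omega : 0 < k)
    have hknR : (k : ℝ) < n := by exact_mod_cast hkn
    refine mul_nonneg (sub_pos.2 hknR).le (pos_of_mul_pos_right (a := (k : ℝ))
      (pos_of_mul_pos_right (a := U - L) ?_ hUL.le) hk0.le).le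
    push_cast at h2
    linear_combination hpos + h2
  · intro j hj
    rw [oelCoeff, if_neg (by omega), if_neg (by omega), if_pos (by omega)]
    split_ifs with h3 h4
    · have h5 : ∑ j ∈ Finset.Icc 1 (n - 1), c j = ∑ j ∈ Finset.Icc (m + 1) k, c j :=
        sum_Icc_eq_sum_Icc (by omega) (by omega) hbelow (fun j h1 h2 => habove j h1 (by omega))
          (fun _ _ _ => rfl)
      rw [← hsum, h5, h3, ← Finset.sum_Ico_add_eq_sum_Icc (by omega : m + 1 ≤ k)]
      have h6 : ∑ j ∈ Finset.Ico (m + 1) k, c j =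
          ∑ j ∈ Finset.Icc (m + 1) (k - 1), highCoeff n m j := by
        refine Finset.sum_congr (by ext; simp; omega) fun j hj => ?_
        rw [Finset.mem_Icc] at hj
        exact hhigh j hj.1 (by omega)
      rw [h6]; ring
    · exact hhigh j h4.1 (by omega)
    · rcases Nat.eq_zero_or_pos j with rfl | hj0
      · exact hc0
      · rcases Nat.lt_or_ge j (m + 1) with h5 | h5
        · exact hbelow j hj0 h5
        · exact habove j (by omega) hj

lemma eq_oelCoeff_top (hLU : L < U) (hm : 1 ≤ m) (hmn : m < n)
    (hpos : 0 < surplus n m c (step L U n))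
    (hzero : ∀ i, i ≤ n → i ≠ n → surplus n m c (step L U i) = 0) :
    Odd ((n : ℤ) - m) ∧ ∀ j, j < n → c j = oelCoeff n m L U n j := by
  have hE : ∀ j, 1 ≤ j → j < n → slope n m c j = 0 := fun j h1 h2 =>
    slope_eq_zero_of_surplus_step hLU hmn hzero h1 h2.le h2.ne (by omega)
  have hbelow := eq_zero_of_slope_eq_zero_below (c := c) (le_refl (m + 1))
    (by omega : m + 1 ≤ n) fun j h1 h2 => hE j h1 (by omega)
  have hhigh := eq_highCoeff_of_slope_eq_zero (c := c) hm le_rfl (hbelow m hm (by omega))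
    fun j h1 h2 => hE j (by omega) h2
  have h1 := slope_self_of_surplus_step hmn hzero (by omega) le_rfl
  refine ⟨odd_sub_of_slope_pos hmn (by rw [sub_self, zero_mul]) hhigh
    (pos_of_mul_pos_right (h1 ▸ hpos) (sub_pos.2 hLU).le), ?_⟩
  intro j hj
  rw [oelCoeff, if_neg (by omega), if_neg (by omega), if_neg (by omega)]
  split_ifs with h2 h3
  · rw [h2, coeff_zero_of_surplus_step_zero hmn (hzero 0 (by omega) (by omega)),
      sum_Icc_eq_sum_Icc (by omega : 1 ≤ m + 1) le_rfl hbelow (fun j _ _ => by omega)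
        (fun j h1 h2 => hhigh j h1 (by omega))]
  · exact hhigh j h3.1 hj
  · exact hbelow j (by omega) (by omega)

/-- If the total payment is positive at the `k`-th step profile and vanishes at the others, then
the coefficients are those of the OEL mechanism with index `k`, and `k - m` is odd. -/
lemma eq_oelCoeff_of_surplus_step (hLU : L < U) (hm : 1 ≤ m) (hmn : m < n)
    (hk : k ≤ n) (hpos : 0 < surplus n m c (step L U k))
    (hzero : ∀ i, i ≤ n → i ≠ k → surplus n m c (step L U i) = 0) :
    Odd ((k : ℤ) - m) ∧ ∀ j, j < n → c j = oelCoeff n m L U k j := by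
  rcases Nat.eq_zero_or_pos k with rfl | hk0
  · exact eq_oelCoeff_zero hLU hm hmn hpos hzero
  rcases lt_trichotomy k m with h | rfl | h
  · exact eq_oelCoeff_low hLU hm hmn hk0 h hpos hzero
  · exact absurd hpos (surplus_step_neg hLU hm hmn hzero).not_gt
  rcases hk.lt_or_eq with h2 | rfl
  · exact eq_oelCoeff_high hLU hm hmn h h2 hpos hzero
  · exact eq_oelCoeff_top hLU hm hmn hpos hzero

end Steps

/-! ### At most one positive step value -/

lemma surplus_congr (hmn : m < n) {c S S' : ℕ → ℝ} (h : ∀ j, 1 ≤ j → j ≤ n → S j = S' j) :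
    surplus n m c S = surplus n m c S' := by
  rw [surplus_eq_slope hmn, surplus_eq_slope hmn]
  congr 1
  refine Finset.sum_congr rfl fun j hj => ?_
  rw [Finset.mem_Icc] at hj
  rw [h j hj.1 hj.2]

lemma sorted_antitone (x : Fin n → ℝ) (hx : ∀ i, x i ∈ Set.Icc L U) (hLU : L ≤ U)
    (σ : Equiv.Perm (Fin n)) (hσ : Antitone (x ∘ σ)) : Antitone (sorted L U x σ) := by
  refine antitone_nat_of_succ_le fun k => ?_
  rcases Nat.lt_or_ge k n with h | h
  · rw [sorted_succ _ _ _ _ _ h]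
    cases k with
    | zero => simpa [sorted] using (hx _).2
    | succ k =>
      rw [sorted_succ _ _ _ _ _ (by omega)]
      exact hσ (Fin.mk_le_mk.2 (Nat.le_succ k))
  · rw [sorted, if_neg (by omega), dif_neg (by omega), sorted]
    split_ifs
    · exact hLU
    · exact (hx _).1
    · exact le_rfl

lemma exists_antitone_comp (x : Fin n → ℝ) : ∃ σ : Equiv.Perm (Fin n), Antitone (x ∘ σ) := by
  refine ⟨Tuple.sort (fun i => -x i), fun a b hab => ?_⟩
  exact neg_le_neg_iff.1 (Tuple.monotone_sort (fun i => -x i) hab)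

lemma surplus_step_nonneg (hL : 0 ≤ L) (hLU : L ≤ U) (hmn : m < n)
    {M : Mechanism (auction n m L U)} (hM : M.Efficient) (hN : M.NonDeficit) {c : ℕ → ℝ}
    (hc : M.HasRedistribution (linearRedistribution c)) (k : ℕ) :
    0 ≤ surplus n m c (step L U k) := by
  have hx : ∀ i : Fin n, (if (i : ℕ) < k then U else L) ∈ Set.Icc L U := by
    intro i; split_ifs
    · exact ⟨hLU, le_rfl⟩
    · exact ⟨le_rfl, hLU⟩
  have hanti : Antitone (fun i : Fin n => if (i : ℕ) < k then U else L) := by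
    intro a b hab
    have : (a : ℕ) ≤ b := hab
    dsimp only
    split_ifs
    · exact le_rfl
    · omega
    · exact hLU
    · exact le_rfl
  have h := sum_payment hL hmn hM hc (profileOf (m := m) _ hx) 1 hanti
  rw [bids_profileOf] at h
  have h2 := hN (profileOf (m := m) _ hx)
  rw [h] at h2
  refine h2.trans_eq (surplus_congr hmn fun j hj hjn => ?_)
  obtain ⟨j, rfl⟩ := Nat.exists_eq_add_of_le' hj
  rw [sorted_succ _ _ _ _ _ (by omega)]
  simp only [step, Nat.succ_le_iff, Equiv.Perm.one_apply]
  by_cases hjk : j < k <;> simp [hjk]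

/-- If all but one of the types are `U - δ, U - 2δ, …, U - (n-1)δ` with `δ = (U - L) / n`, then
any two gaps of the sorted profile add up to at least `δ`: the free type can close only one of
the two gaps next to it. -/
lemma le_gap_add_gap (x y : Fin n → ℝ) (hn : 1 ≤ n) (hLU : L ≤ U)
    (hx : ∀ i, x i ∈ Set.Icc L U)
    (hy : ∀ i, y i = U - ((i : ℕ) + 1 : ℕ) * ((U - L) / n))
    (hxy : ∀ i, i ≠ (⟨n - 1, by omega⟩ : Fin n) → x i = y i)
    (σ : Equiv.Perm (Fin n)) (hσ : Antitone (x ∘ σ)) {p q : ℕ} (hpq : p < q) (hq : q ≤ n) :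
    (U - L) / n ≤ sorted L U x σ p - sorted L U x σ (p + 1) +
      (sorted L U x σ q - sorted L U x σ (q + 1)) := by
  set δ := (U - L) / n with hδ
  have hδ0 : 0 ≤ δ := div_nonneg (sub_nonneg.2 hLU) (Nat.cast_nonneg n)
  have hn0 : (n : ℝ) ≠ 0 := by exact_mod_cast (by omega : n ≠ 0)
  set S := sorted L U x σ with hS
  have hanti : Antitone S := sorted_antitone x hx hLU σ hσ
  set i₀ : Fin n := ⟨n - 1, by omega⟩ with hi₀
  set k : Fin n := σ.symm i₀ with hk
  have hkn : (k : ℕ) < n := k.2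
  have hyanti : Antitone (y ∘ (1 : Equiv.Perm (Fin n))) := by
    intro a b hab
    have : ((a : ℕ) : ℝ) ≤ (b : ℕ) := by exact_mod_cast (show (a : ℕ) ≤ b from hab)
    simp only [Function.comp, Equiv.Perm.one_apply, hy]
    push_cast
    nlinarith
  -- The values `U - j δ` are those of `S` without position `k + 1`, the place of the free type.
  have hX : ∀ j : ℕ, j ≤ n → U - j * δ = if j ≤ k then S j else S (j + 1) := by
    intro j hj
    rcases Nat.eq_zero_or_pos j with rfl | hj0
    · simp [hS, sorted]
    rcases hj.lt_or_eq with hjn | rfl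
    · have h1 := nthHighest_others L U x σ hσ k j hj0 hjn
      have h2 := nthHighest_others L U y 1 hyanti i₀ j hj0 hjn
      rw [hk, Equiv.apply_symm_apply] at h1
      have h3 : (fun a : {a // a ≠ i₀} => x a) = fun a : {a // a ≠ i₀} => y a :=
        funext fun a => hxy a a.2
      rw [← h1, h3]
      rw [Equiv.Perm.one_apply, if_pos (by rw [hi₀]; simp only; omega)] at h2
      rw [h2]
      obtain ⟨j, rfl⟩ := Nat.exists_eq_add_of_le' hj0
      rw [sorted_succ _ _ _ _ _ (by omega), Equiv.Perm.one_apply, hy]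
    · rw [if_neg (by omega), hS, sorted, if_neg (by omega), dif_neg (by omega), hδ]
      field_simp
      ring
  have hg : ∀ j, 0 ≤ S j - S (j + 1) := fun j => sub_nonneg.2 (hanti (Nat.le_succ j))
  have hgap1 : ∀ j : ℕ, j < k → S j - S (j + 1) = δ := by
    intro j hj
    have h1 := hX j (by omega)
    have h2 := hX (j + 1) (by omega)
    rw [if_pos (by omega)] at h1 h2
    rw [← h1, ← h2]; push_cast; ring
  have hgap2 : ∀ j : ℕ, (k : ℕ) + 1 < j → j ≤ n → S j - S (j + 1) = δ := by
    intro j hj hjn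
    obtain ⟨j, rfl⟩ : ∃ i, j = i + 1 := ⟨j - 1, by omega⟩
    have h1 := hX j (by omega)
    have h2 := hX (j + 1) (by omega)
    rw [if_neg (by omega)] at h1 h2
    rw [← h1, ← h2]; push_cast; ring
  have hgap3 : S k - S (k + 2) = δ := by
    have h1 := hX k (by omega)
    have h2 := hX (k + 1) (by omega)
    rw [if_pos le_rfl] at h1
    rw [if_neg (by omega)] at h2
    rw [← h1, ← h2]; push_cast; ring
  by_cases h1 : p < k
  · linarith [hgap1 p h1, hg q]
  by_cases h2 : (k : ℕ) + 1 < q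
  · linarith [hgap2 q h2 hq, hg p]
  rw [show p = (k : ℕ) by omega, show q = (k : ℕ) + 1 by omega]
  linarith

/-- For an undominated mechanism, at most one of the step profiles has a positive surplus:
otherwise the surplus is bounded away from zero for all types of one agent, against types of the
others that are equally spaced. -/
lemma surplus_step_eq_zero (hL : 0 ≤ L) (hLU : L < U) (hmn : m < n)
    {M : Mechanism (auction n m L U)} (hG : M.IsGroves) (hN : M.NonDeficit)
    (hU : M.IndividuallyUndominated) {c : ℕ → ℝ}
    (hc : M.HasRedistribution (linearRedistribution c)) {p q : ℕ} (hpq : p < q) (hq : q ≤ n) :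
    surplus n m c (step L U p) ≤ 0 ∨ surplus n m c (step L U q) ≤ 0 := by
  by_contra! hV
  set μ := min (surplus n m c (step L U p)) (surplus n m c (step L U q)) with hμ
  have hμ0 : 0 < μ := lt_min hV.1 hV.2
  have hn0 : (0 : ℝ) < n := by exact_mod_cast (by omega : 0 < n)
  have hUL : 0 < U - L := sub_pos.2 hLU
  let y : Fin n → ℝ := fun i => U - ((i : ℕ) + 1 : ℕ) * ((U - L) / n)
  have hy : ∀ i, y i ∈ Set.Icc L U := by
    intro i
    have h1 : (((i : ℕ) + 1 : ℕ) : ℝ) ≤ n := by exact_mod_cast i.2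
    have h2 : 0 ≤ (U - L) / n := by positivity
    have h3 : n * ((U - L) / n) = U - L := by field_simp
    constructor
    · have := mul_le_mul_of_nonneg_right h1 h2
      simp only [y]; linarith
    · have : 0 ≤ (((i : ℕ) + 1 : ℕ) : ℝ) * ((U - L) / n) := by positivity
      simp only [y]; linarith
  obtain ⟨θ, hθ, hlt⟩ := hU.exists_sum_lt hG hN (profileOf y hy) ⟨n - 1, by omega⟩
    (div_pos hμ0 hn0)
  obtain ⟨σ, hσ⟩ := exists_antitone_comp (bids θ)
  rw [sum_payment hL hmn hG.1 hc θ σ hσ] at hlt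
  have hgap := le_gap_add_gap (bids θ) y (by omega) hLU.le (bids_mem θ) (fun _ => rfl)
    (fun i hi => congrArg bid (hθ i hi)) σ hσ hpq hq
  have hsum := surplus_eq_sum_gap hmn c (sorted L U (bids θ) σ) L U (by simp [sorted])
    (by simp [sorted])
  set S := sorted L U (bids θ) σ with hS
  have hg : ∀ j, 0 ≤ S j - S (j + 1) := fun j =>
    sub_nonneg.2 (sorted_antitone _ (bids_mem θ) hLU.le σ hσ (Nat.le_succ j))
  have hsub : ∑ k ∈ {p, q}, (S k - S (k + 1)) * surplus n m c (step L U k) ≤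
      (U - L) * surplus n m c S := by
    rw [hsum]
    refine Finset.sum_le_sum_of_subset_of_nonneg ?_ fun k _ _ =>
      mul_nonneg (hg k) (surplus_step_nonneg hL hLU.le hmn hG.1 hN hc k)
    intro k hk
    simp only [Finset.mem_insert, Finset.mem_singleton] at hk
    rw [Finset.mem_range]; omega
  rw [Finset.sum_pair hpq.ne] at hsub
  have h1 := mul_le_mul_of_nonneg_left (min_le_left _ _ : μ ≤ surplus n m c (step L U p)) (hg p)
  have h2 := mul_le_mul_of_nonneg_left (min_le_right _ _ : μ ≤ surplus n m c (step L U q)) (hg q)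
  have h3 := mul_le_mul_of_nonneg_right hgap hμ0.le
  have h4 := mul_lt_mul_of_pos_left hlt hUL
  have h5 : (U - L) / n * μ = (U - L) * (μ / n) := by ring
  linarith

/-! ### Comparison with the OEL mechanisms -/

lemma hasRedistribution_congr {M : Mechanism (auction n m L U)} {c c' : ℕ → ℝ} (hn : 0 < n)
    (hc : M.HasRedistribution (linearRedistribution c)) (h : ∀ j, j < n → c j = c' j) :
    M.HasRedistribution (linearRedistribution c') := by
  intro θ i
  rw [hc θ i, linearRedistribution, linearRedistribution, h 0 hn]
  congr 2
  refine Finset.sum_congr rfl fun j hj => ?_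
  rw [Finset.mem_Icc] at hj
  rw [h j (by omega)]

lemma linearRedistribution_of_eq (θ : (auction n m L L).Profile) (c : ℕ → ℝ) (i : Fin n) :
    linearRedistribution c i (DecisionProblem.others i θ) =
      c 0 + L * ∑ j ∈ Finset.Icc 1 (n - 1), c j := by
  have hb : bids θ = fun _ => L := funext fun a => le_antisymm (bids_mem θ a).2 (bids_mem θ a).1
  change c 0 + ∑ j ∈ Finset.Icc 1 (n - 1),
    c j * nthHighest (fun a : {a // a ≠ i} => bids θ a) j = _
  rw [Finset.mul_sum]
  congr 1
  refine Finset.sum_congr rfl fun j hj => ?_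
  rw [Finset.mem_Icc] at hj
  have h := nthHighest_ne (bids θ) 1 (by rw [hb]; exact antitone_const) i j hj.1 (by omega)
  rw [Equiv.Perm.one_apply] at h
  rw [h, hb, ite_self, mul_comm]

lemma oelCoeff_succ_sum (hmn : m < n) :
    oelCoeff n m L L (m + 1) 0 + L * ∑ j ∈ Finset.Icc 1 (n - 1), oelCoeff n m L L (m + 1) j =
      L * m / n := by
  rcases Nat.lt_or_ge (m + 1) n with h | h
  · have h1 : ∀ j, oelCoeff n m L L (m + 1) j = if j = m + 1 then (m : ℝ) / n else 0 := by
      intro j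
      rw [oelCoeff, if_neg (by omega), if_neg (by omega), if_pos (by omega),
        if_neg (by omega : ¬ (m + 1 ≤ j ∧ j ≤ m + 1 - 1))]
      simp
    simp_rw [h1]
    rw [Finset.sum_ite_eq', if_pos (Finset.mem_Icc.2 ⟨by omega, by omega⟩), if_neg (by omega)]
    ring
  · obtain rfl : n = m + 1 := by omega
    have h1 : ∀ j, oelCoeff (m + 1) m L L (m + 1) j =
        if j = 0 then L * m / (m + 1 : ℕ) else 0 := by
      intro j
      rw [oelCoeff, if_neg (by omega), if_neg (by omega), if_neg (by omega),
        if_neg (by omega : ¬ (m + 1 ≤ j ∧ j ≤ m + 1 - 1))]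
      simp
    simp_rw [h1]
    rw [Finset.sum_ite_eq', if_pos trivial, if_neg (by simp)]
    ring

/-- When there is only one type, all redistribution functions are constant, and the mechanism
with index `m + 1` pays back the whole of the VCG payments. -/
lemma isOEL_of_eq (hL : 0 ≤ L) (hmn : m < n) (M : Mechanism (auction n m L L))
    (hG : M.IsGroves) (hN : M.NonDeficit) (hlin : IsAnonymousLinear M)
    (hU : M.IndividuallyUndominated) : IsOEL M := by
  obtain ⟨c, hc⟩ := hlin
  have hsingle : ∀ θ : (auction n m L L).Profile, bids θ = fun _ => L := fun θ =>
    funext fun a => le_antisymm (bids_mem θ a).2 (bids_mem θ a).1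
  have hsum : ∀ θ : (auction n m L L).Profile, ∑ i, M.t θ i =
      m * L - n * (c 0 + L * ∑ j ∈ Finset.Icc 1 (n - 1), c j) := by
    intro θ
    rw [sum_payment hL hmn hG.1 hc θ 1 (by rw [hsingle]; exact antitone_const)]
    exact surplus_const c _ hmn L fun j hj hjn => by simp [sorted, hsingle]
  have hn0 : (n : ℝ) ≠ 0 := by exact_mod_cast (by omega : n ≠ 0)
  let θ₀ : (auction n m L L).Profile := profileOf (fun _ => L) fun _ => ⟨le_rfl, le_rfl⟩
  have hzero : (m : ℝ) * L - n * (c 0 + L * ∑ j ∈ Finset.Icc 1 (n - 1), c j) = 0 := by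
    refine le_antisymm (le_of_forall_pos_lt_add fun ε hε => ?_) (hsum θ₀ ▸ hN θ₀)
    obtain ⟨θ, -, h⟩ := hU.exists_sum_lt hG hN θ₀ ⟨0, by omega⟩ hε
    rwa [hsum, ← zero_add ε] at h
  refine ⟨hG, m + 1, hmn, ⟨0, by push_cast; ring⟩, fun θ i => ?_⟩
  rw [hc θ i, linearRedistribution_of_eq, linearRedistribution_of_eq, oelCoeff_succ_sum hmn]
  congr 1
  field_simp
  linarith

end UnitDemand

theorem mainTheorem3 (n m : ℕ) (hm : 1 ≤ m) (hmn : m < n) (L U : ℝ) (hL : 0 ≤ L) (hLU : L ≤ U)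
    (M : Mechanism (UnitDemand.auction n m L U)) (hGroves : M.IsGroves)
    (hNonDeficit : M.NonDeficit) (hLinear : UnitDemand.IsAnonymousLinear M)
    (hUndominated : M.IndividuallyUndominated) :
    UnitDemand.IsOEL M := by
  rcases hLU.eq_or_lt with rfl | hlt
  · exact UnitDemand.isOEL_of_eq hL hmn M hGroves hNonDeficit hLinear hUndominated
  obtain ⟨c, hc⟩ := hLinear
  have hnonneg := UnitDemand.surplus_step_nonneg hL hLU hmn hGroves.1 hNonDeficit hc
  have hpair : ∀ p q, p ≤ n → q ≤ n → p ≠ q →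
      0 < UnitDemand.surplus n m c (UnitDemand.step L U p) →
      UnitDemand.surplus n m c (UnitDemand.step L U q) = 0 := by
    intro p q hp hq hpq hpos
    refine le_antisymm ?_ (hnonneg q)
    rcases hpq.lt_or_gt with h | h
    · exact (UnitDemand.surplus_step_eq_zero hL hlt hmn hGroves hNonDeficit hUndominated hc h
        hq).resolve_left hpos.not_ge
    · exact (UnitDemand.surplus_step_eq_zero hL hlt hmn hGroves hNonDeficit hUndominated hc h
        hp).resolve_right hpos.not_ge
  obtain ⟨k, hk, hpos⟩ : ∃ k ≤ n, 0 < UnitDemand.surplus n m c (UnitDemand.step L U k) := by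
    by_contra! hall
    exact (UnitDemand.surplus_step_neg hlt hm hmn fun i hi _ =>
      le_antisymm (hall i hi) (hnonneg i)).not_ge (hnonneg m)
  obtain ⟨hodd, hcoeff⟩ := UnitDemand.eq_oelCoeff_of_surplus_step hlt hm hmn hk hpos
    fun i hi hik => hpair k i hk hi hik.symm hpos
  exact ⟨hGroves, k, hk, hodd, UnitDemand.hasRedistribution_congr (by omega) hc hcoeff⟩
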